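/- **Setting.** Fix a horizon $N\in\mathbb N$. For each stage $k$ let $X_k$ (particle states) be a Polish space that is a monoid with continuous addition, $U_k$ (inputs) a metrizable space, and $W_k$ (global noise) a measurable space with a probability measure $\xi_k$; let $\nu_k\in\mathcal P(X_{k+1})$ be the law of the local, additive noise. Let $\mathcal S_k\subseteq\mathcal P(X_k)$ be the admissible states, with the topology of narrow convergence (for instance $\mathcal S_k=\mathcal P(X_k)$), and let $\emptyset\neq\mathcal U_k\subseteq C(X_k,U_k)$ be the admissible input maps, with the topology of locally uniform convergence (the compact-open topology). The particle dynamics $f_k:X_k\times U_k\times W_k\to X_{k+1}$ induce $$F_k(\mu,u,w)=\big(f_k(\cdot,u(\cdot),w)\big)_{\#}\mu*\nu_k ,$$ which is assumed to map $\mathcal S_k\times\mathcal U_k\times W_k$ into $\mathcal S_{k+1}$. The stage costs are $g_k:\mathcal S_k\times\mathcal U_k\times W_k\to[0,\infty]$, $k<N$, and the terminal cost is $G_N:\mathcal S_N\to[0,\infty]$. **Hypotheses.** For every $k<N$: 1. $f_k(\cdot,\cdot,w)$ is continuous for every $w$, and $f_k(x,u,\cdot)$ is measurable for every $(x,u)$;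 2. $g_k(\cdot,\cdot,w)$ is lower semicontinuous along convergent sequences of $\mathcal S_k\times\mathcal U_k$ for every $w$, and $g_k(\mu,u,\cdot)$ is measurable for every $(\mu,u)$; 3. either $\mathcal U_k$ is compact, or the stage cost is coercive in the input, uniformly for states in compact sets: for every $w\in W_k$, every compact $C\subseteq\mathcal S_k$ and every $c<\infty$ there is a compact $K\subseteq\mathcal U_k$ such that $\mu\in C$, $u\in\mathcal U_k$ and $g_k(\mu,u,w)\le c$ imply $u\in K$. Moreover, $G_N$ is lower semicontinuous. **Dynamic programming recursion.** Let $J_N=G_N$ and, for $k<N$ and $\mu\in\mathcal S_k$, $$J_k(\mu)=\inf_{u\in\mathcal U_k}h_k(\mu,u),\qquad h_k(\mu,u)=\int_{W_k}\big[g_k(\mu,u,w)+J_{k+1}(F_k(\mu,u,w))\big]\,d\xi_k(w).$$ **Control problem.** A policy $\pi=(\pi_k)_k$ consists of maps $\pi_k:\mathcal S_k\to\mathcal U_k$. Its expected cost on the stages $k,\dots,N$ from $\mu\in\mathcal S_k$ is the iterated expectation $$V^\pi_k(\mu)=\int_{W_k}\!\!\cdots\int_{W_{N-1}}\Big[\sum_{h=k}^{N-1}g_h(\mu_h,u_h,w_h)+G_N(\mu_N)\Big]d\xi_{N-1}(w_{N-1})\cdots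 d\xi_k(w_k),$$ where $\mu_k=\mu$, $u_h=\pi_h(\mu_h)$ and $\mu_{h+1}=F_h(\mu_h,u_h,w_h)$. (For arbitrary $\pi$ the integrals are lower integrals.) The policy is admissible if, from every stage and state and with any constant $c\in[0,\infty]$ added to the total cost, the functions integrated in this iterated expectation are all measurable. The optimal cost is $J^\star_k(\mu)=\inf\{V^\pi_k(\mu):\pi\text{ admissible}\}$; the finite-horizon optimal control problem in probability space is the case $k=0$. **Theorem.** Under these hypotheses: * the recursion is well posed: $J_k$ is lower semicontinuous on $\mathcal S_k$ for narrow convergence for every $k\le N$; and for every $k<N$, $\mu\in\mathcal S_k$, the integrand in $h_k(\mu,u)$ is measurable in $w$ for every $u\in\mathcal U_k$, and the infimum defining $J_k(\mu)$ is attained by some $u\in\mathcal U_k$; * solving the recursion solves the control problem: $J_k(\mu)=J^\star_k(\mu)$ for every $k\le N$ and $\mu\in\mathcal S_k$, in particular $J_0$ is the optimal cost. There are policies $\pi$ such that $\pi_k(\mu)$ minimizes $h_k(\mu,\cdot)$ for all $k<N$ and $\mu\in\mathcal S_k$, and these are exactly the admissible policies with $V^\pi_k(\mu)=J^\star_k(\mu)$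 for all $k\le N$ and $\mu\in\mathcal S_k$. -/

import Mathlib

open MeasureTheory Filter Topology
open scoped ENNReal NNReal

/-- Lower semicontinuity along sequences. It is implied by (topological) lower semicontinuity and
is equivalent to it on metrizable spaces. -/
def SeqLowerSemicontinuous {α : Type*} [TopologicalSpace α] (f : α → ℝ≥0∞) : Prop :=
  ∀ (a : ℕ → α) (b : α), Tendsto a atTop (𝓝 b) → f b ≤ liminf (fun n => f (a n)) atTop

theorem LowerSemicontinuous.seqLowerSemicontinuous {α : Type*} [TopologicalSpace α]
    {f : α → ℝ≥0∞} (hf : LowerSemicontinuous f) : SeqLowerSemicontinuous f := by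
  intro a b hab
  refine le_of_forall_lt fun y hy => ?_
  obtain ⟨z, hyz, hzb⟩ := exists_between hy
  refine lt_of_lt_of_le hyz (le_liminf_of_le (by isBoundedDefault) ?_)
  filter_upwards [hab.eventually (hf b z hzb)] with n hn using hn.le

/-- The law `(f (·, u ·))_# μ ∗ ν` of `f (x, u x) + w'` for independent `x ∼ μ` and `w' ∼ ν`. -/
noncomputable def nextMeasure {A B C : Type*} [TopologicalSpace A] [MeasurableSpace A]
    [BorelSpace A] [TopologicalSpace B] [TopologicalSpace C] [PolishSpace C] [MeasurableSpace C]
    [BorelSpace C] [AddMonoid C] [ContinuousAdd C] (f : C(A × B, C)) (u : C(A, B))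
    (ν : ProbabilityMeasure C) (μ : ProbabilityMeasure A) : ProbabilityMeasure C :=
  ⟨((μ : Measure A).map fun x => f (x, u x)).conv (ν : Measure C),
    haveI : IsProbabilityMeasure ((μ : Measure A).map fun x => f (x, u x)) :=
      Measure.isProbabilityMeasure_map
        (f.continuous.comp (continuous_id.prodMk u.continuous)).measurable.aemeasurable
    inferInstance⟩

/-- The data of an `N`-stage optimal control problem whose state is a probability measure.

At stage `k` the particles live in `X k`, the input of a particle lies in `U k`, and the global
noise (common to all particles) in `W k`. A particle at `x` moves to `f k (x, u x, w) + w'`, where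
`w` is the global noise with law `ξ k`, `w'` is the local noise with law `ν k` (independent across
particles), and `u` is the input map. Only the stages `k < N` (and the state space and states of
stage `N`) matter; the data at later stages can be filled with one-point spaces. -/
structure MeasureControlProblem (N : ℕ) (X : ℕ → Type*) (U : ℕ → Type*) (W : ℕ → Type*)
    [∀ k, TopologicalSpace (X k)] [∀ k, PolishSpace (X k)] [∀ k, MeasurableSpace (X k)]
    [∀ k, BorelSpace (X k)] [∀ k, AddMonoid (X k)] [∀ k, ContinuousAdd (X k)]
    [∀ k, TopologicalSpace (U k)] [∀ k, MeasurableSpace (W k)] where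
  /-- The admissible probability measures at each stage (possibly all of them). -/
  states : ∀ k, Set (ProbabilityMeasure (X k))
  /-- The admissible input maps, a set of continuous maps. -/
  inputs : ∀ k, Set C(X k, U k)
  inputs_nonempty : ∀ k, (inputs k).Nonempty
  /-- The dynamics of a particle, continuous in the pair (particle, input). -/
  f : ∀ k, W k → C(X k × U k, X (k + 1))
  /-- The law of the global noise. -/
  ξ : ∀ k, ProbabilityMeasure (W k)
  /-- The law of the local, additive noise. -/
  ν : ∀ k, ProbabilityMeasure (X (k + 1))
  /-- The dynamics preserve admissibility of the states. -/
  dynamics_mem : ∀ k, ∀ μ ∈ states k, ∀ u ∈ inputs k, ∀ w : W k,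
    nextMeasure (f k w) u (ν k) μ ∈ states (k + 1)
  /-- The stage costs. -/
  stageCost : ∀ k, states k → inputs k → W k → ℝ≥0∞
  /-- The terminal cost. -/
  terminalCost : states N → ℝ≥0∞

namespace MeasureControlProblem

variable {N : ℕ} {X : ℕ → Type*} {U : ℕ → Type*} {W : ℕ → Type*}
  [∀ k, TopologicalSpace (X k)] [∀ k, PolishSpace (X k)] [∀ k, MeasurableSpace (X k)]
  [∀ k, BorelSpace (X k)] [∀ k, AddMonoid (X k)] [∀ k, ContinuousAdd (X k)]
  [∀ k, TopologicalSpace (U k)] [∀ k, MeasurableSpace (W k)]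

/-- The dynamics in the space of probability measures, `μ ↦ (f k w (·, u ·))_# μ ∗ ν k`. -/
noncomputable def dynamics (P : MeasureControlProblem N X U W) (k : ℕ) (μ : P.states k)
    (u : P.inputs k) (w : W k) : P.states (k + 1) :=
  ⟨nextMeasure (P.f k w) u (P.ν k) μ, P.dynamics_mem k μ μ.2 u u.2 w⟩

/-- `g` is coercive in the input, uniformly for states in compact sets: all inputs whose cost is at
most `c` for some state in a given compact set lie in one compact set of admissible inputs. -/
def CoerciveInInput {S V : Type*} [TopologicalSpace S] [TopologicalSpace V]
    (g : S → V → ℝ≥0∞) : Prop :=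
  ∀ C : Set S, IsCompact C → ∀ c : ℝ≥0, ∃ K : Set V, IsCompact K ∧
    ∀ μ ∈ C, ∀ u, g μ u ≤ c → u ∈ K

/-- The standing hypotheses. Sets of measures carry the topology of narrow convergence, sets of
input maps that of locally uniform convergence (the compact-open topology). -/
structure StandingHypotheses (P : MeasureControlProblem N X U W) : Prop where
  measurable_f : ∀ k < N, ∀ x u, Measurable fun w => P.f k w (x, u)
  measurable_stageCost : ∀ k < N, ∀ μ u, Measurable (P.stageCost k μ u)
  stageCost_lsc : ∀ k < N, ∀ w,
    SeqLowerSemicontinuous fun p : P.states k × P.inputs k => P.stageCost k p.1 p.2 w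
  compact_or_coercive : ∀ k < N, IsCompact (P.inputs k) ∨
    ∀ w, CoerciveInInput fun μ u => P.stageCost k μ u w
  terminalCost_lsc : LowerSemicontinuous P.terminalCost

/-- The cost-to-go `J_k`, by the dynamic programming recursion `J_N = G` and
`J_k μ = inf_u E_w [g_k(μ, u, w) + J_{k+1}(μ⁺)]`, where `μ⁺` is the next state. -/
noncomputable def costToGo (P : MeasureControlProblem N X U W) (k : ℕ) (μ : P.states k) : ℝ≥0∞ :=
  if hk : k < N then
    ⨅ u : P.inputs k, ∫⁻ w, (P.stageCost k μ u w + costToGo P (k + 1) (P.dynamics k μ u w))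
      ∂(P.ξ k : Measure (W k))
  else if hN : k = N then P.terminalCost (hN ▸ μ) else 0
termination_by N - k

/-- The function minimized over the inputs `u` in the dynamic programming recursion. -/
noncomputable def inputValue (P : MeasureControlProblem N X U W) (k : ℕ) (μ : P.states k)
    (u : P.inputs k) : ℝ≥0∞ :=
  ∫⁻ w, (P.stageCost k μ u w + P.costToGo (k + 1) (P.dynamics k μ u w)) ∂(P.ξ k : Measure (W k))

theorem costToGo_terminal (P : MeasureControlProblem N X U W) :
    P.costToGo N = P.terminalCost := by
  funext μ
  rw [costToGo]
  simp

theorem costToGo_of_lt (P : MeasureControlProblem N X U W) {k : ℕ} (hk : k < N)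
    (μ : P.states k) : P.costToGo k μ = ⨅ u, P.inputValue k μ u := by
  rw [costToGo, dif_pos hk]
  rfl

/-- A (closed-loop) policy: at each stage, an admissible input for each state. -/
abbrev Policy (P : MeasureControlProblem N X U W) := ∀ k, P.states k → P.inputs k

/-- The iterated expectation `E_{w_k} ⋯ E_{w_{N-1}} [c + ∑_{k ≤ h < N} g_h(μ_h, u_h, w_h) + G(μ_N)]`
along the closed-loop trajectory `u_h = π h μ_h`, `μ_{h+1} = dynamics h μ_h u_h w_h` started from
`μ_k = μ`; the argument `c` accumulates the cost incurred before stage `k`. -/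
noncomputable def accumulatedCost (P : MeasureControlProblem N X U W) (π : P.Policy) (k : ℕ)
    (c : ℝ≥0∞) (μ : P.states k) : ℝ≥0∞ :=
  if hk : k < N then
    ∫⁻ w, accumulatedCost P π (k + 1) (c + P.stageCost k μ (π k μ) w)
      (P.dynamics k μ (π k μ) w) ∂(P.ξ k : Measure (W k))
  else if hN : k = N then c + P.terminalCost (hN ▸ μ) else c
termination_by N - k

theorem accumulatedCost_terminal (P : MeasureControlProblem N X U W) (π : P.Policy) (c : ℝ≥0∞)
    (μ : P.states N) : P.accumulatedCost π N c μ = c + P.terminalCost μ := by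
  rw [accumulatedCost]
  simp

theorem accumulatedCost_of_lt (P : MeasureControlProblem N X U W) (π : P.Policy) {k : ℕ}
    (hk : k < N) (c : ℝ≥0∞) (μ : P.states k) :
    P.accumulatedCost π k c μ = ∫⁻ w, P.accumulatedCost π (k + 1)
      (c + P.stageCost k μ (π k μ) w) (P.dynamics k μ (π k μ) w) ∂(P.ξ k : Measure (W k)) := by
  rw [accumulatedCost, dif_pos hk]

/-- The expected total cost of a policy on the stages `k, …, N`, started from `μ`. -/
noncomputable def expectedCost (P : MeasureControlProblem N X U W) (π : P.Policy) (k : ℕ)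
    (μ : P.states k) : ℝ≥0∞ :=
  P.accumulatedCost π k 0 μ

/-- The policies with a well-defined expected cost: all functions that are integrated in the
iterated expectation are measurable. -/
def Admissible (P : MeasureControlProblem N X U W) (π : P.Policy) : Prop :=
  ∀ k < N, ∀ (c : ℝ≥0∞) (μ : P.states k), Measurable fun w =>
    P.accumulatedCost π (k + 1) (c + P.stageCost k μ (π k μ) w) (P.dynamics k μ (π k μ) w)

/-- The optimal cost of the control problem on the stages `k, …, N`, started from `μ`; `k = 0` is
the finite-horizon optimal control problem itself. -/
noncomputable def optimalCost (P : MeasureControlProblem N X U W) (k : ℕ) (μ : P.states k) :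
    ℝ≥0∞ :=
  ⨅ (π : P.Policy) (_ : P.Admissible π), P.expectedCost π k μ

/-- A policy that solves the dynamic programming recursion: it picks a minimizer at every stage and
state. -/
def SolvesRecursion (P : MeasureControlProblem N X U W) (π : P.Policy) : Prop :=
  ∀ k < N, ∀ μ : P.states k, IsMinOn (P.inputValue k μ) Set.univ (π k μ)

end MeasureControlProblem

/-! Backward induction carries lower semicontinuity from `J_{k+1}` to `J_k`. Let `μ_n → μ` and let
`u_n` be any inputs whose values have finite liminf. By Fatou, along a subsequence realizing it, the
integrands have finite liminf at some noise value `w`. Coercivity at that single `w`, applied to the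
compact set `{μ} ∪ {μ_n}`, confines a further subsequence of inputs to a compact set, hence yields a
limit input `u`. Fatou again, now with lower semicontinuity for every `w`, bounds the value of `(μ,
u)` by the liminf (`exists_lintegral_le_liminf`). Constant `μ_n` with a minimizing sequence `u_n`
gives attainment; minimizers `u_n` at `μ_n` give lower semicontinuity.

Three facts support this. The next state is sequentially continuous in state and input
(`tendsto_nextMeasure`). It is Giry measurable in the noise, and narrowly open sets pull back to
measurable sets because countably many integrals induce the narrow topology
(`isInducing_apprSeqIntegrals`). Compact sets of input maps are sequentially compact
(`ContinuousMap.isSeqCompact_of_isCompact`).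

Optimality is then a verification argument: the cost-to-go bounds every policy's cost from below,
with equality for policies that pick minimizers. -/

/-! ### Narrow topology and measurability. -/

open TopologicalSpace in
/-- The finite unions of the members of a countable basis. -/
def finiteBasisUnion (X : Type*) [TopologicalSpace X] [SecondCountableTopology X]
    (t : Finset (countableBasis X)) : Set X :=
  ⋃ b ∈ t, (b : Set X)

open TopologicalSpace in
theorem isOpen_finiteBasisUnion {X : Type*} [TopologicalSpace X] [SecondCountableTopology X]
    (t : Finset (countableBasis X)) : IsOpen (finiteBasisUnion X t) :=
  isOpen_biUnion fun b _ => isOpen_of_mem_countableBasis b.2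

open TopologicalSpace in
theorem iInter_compl_finiteBasisUnion {X : Type*} [TopologicalSpace X]
    [SecondCountableTopology X] {F : Set X} (hF : IsClosed F) :
    ⋂ t : {t : Finset (countableBasis X) // ∀ b ∈ t, (b : Set X) ⊆ Fᶜ},
      (finiteBasisUnion X t.1)ᶜ = F := by
  refine Set.Subset.antisymm (fun x hx => ?_) (Set.subset_iInter fun t => ?_)
  · by_contra hxF
    obtain ⟨b, hb, hxb, hbF⟩ :=
      (isBasis_countableBasis X).exists_subset_of_mem_open hxF hF.isOpen_compl
    refine Set.mem_iInter.1 hx ⟨{⟨b, hb⟩}, by simpa using hbF⟩ ?_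
    simpa [finiteBasisUnion] using hxb
  · rw [Set.subset_compl_comm]
    exact Set.iUnion₂_subset t.2

open TopologicalSpace in
theorem directed_compl_finiteBasisUnion {X : Type*} [TopologicalSpace X]
    [SecondCountableTopology X] (F : Set X) :
    Directed (· ⊇ ·) fun t : {t : Finset (countableBasis X) // ∀ b ∈ t, (b : Set X) ⊆ Fᶜ} =>
      (finiteBasisUnion X t.1)ᶜ := by
  classical
  intro s t
  refine ⟨⟨s.1 ∪ t.1, fun b hb => (Finset.mem_union.1 hb).elim (s.2 b) (t.2 b)⟩, ?_, ?_⟩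
  · refine Set.compl_subset_compl.2 (Set.biUnion_subset_biUnion_left fun b hb => ?_)
    exact Finset.mem_union_left _ hb
  · refine Set.compl_subset_compl.2 (Set.biUnion_subset_biUnion_left fun b hb => ?_)
    exact Finset.mem_union_right _ hb

-- Continuity from above along a countable directed family; passing to finite unions is what makes
-- the family directed.
open TopologicalSpace in
theorem IsClosed.measure_eq_iInf_compl_finiteBasisUnion {X : Type*} [TopologicalSpace X]
    [SecondCountableTopology X] [MeasurableSpace X] [OpensMeasurableSpace X] {F : Set X}
    (hF : IsClosed F) (μ : Measure X) [IsFiniteMeasure μ] :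
    μ F = ⨅ t : {t : Finset (countableBasis X) // ∀ b ∈ t, (b : Set X) ⊆ Fᶜ},
      μ (finiteBasisUnion X t.1)ᶜ := by
  have : Countable (countableBasis X) := (countable_countableBasis X).to_subtype
  conv_lhs => rw [← iInter_compl_finiteBasisUnion hF]
  exact (directed_compl_finiteBasisUnion F).measure_iInter
    (fun t => (isOpen_finiteBasisUnion t.1).measurableSet.compl.nullMeasurableSet)
    ⟨⟨∅, by simp⟩, measure_ne_top _ _⟩

open TopologicalSpace in
/-- The integrals of the functions that approximate the complements of the finite unions of basic
open sets. -/
noncomputable def apprSeqIntegrals {X : Type*} [TopologicalSpace X] [SecondCountableTopology X]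
    [HasOuterApproxClosed X] [MeasurableSpace X] (μ : ProbabilityMeasure X)
    (p : Finset (countableBasis X) × ℕ) : ℝ≥0∞ :=
  ∫⁻ x, ((isOpen_finiteBasisUnion p.1).isClosed_compl.apprSeq p.2 x : ℝ≥0∞) ∂(μ : Measure X)

/-- The narrow topology on a separable metrizable space is induced by countably many integrals of
bounded continuous functions. -/
theorem isInducing_apprSeqIntegrals (X : Type*) [TopologicalSpace X] [SecondCountableTopology X]
    [HasOuterApproxClosed X] [MeasurableSpace X] [OpensMeasurableSpace X] :
    IsInducing (apprSeqIntegrals (X := X)) := by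
  have : Countable (TopologicalSpace.countableBasis X) :=
    (TopologicalSpace.countable_countableBasis X).to_subtype
  refine isInducing_iff_nhds.2 fun μ => le_antisymm ?_ ?_
  · refine Tendsto.le_comap (tendsto_pi_nhds.2 fun p => ?_)
    exact ProbabilityMeasure.tendsto_iff_forall_lintegral_tendsto.1 tendsto_id _
  · rw [← tendsto_id']
    -- Portmanteau: approximate `F` from outside first by complements of finite basic unions, then
    -- by the functions whose integrals are controlled by the comap filter.
    refine tendsto_of_forall_isClosed_limsup_le' fun F hF => ?_
    rw [hF.measure_eq_iInf_compl_finiteBasisUnion]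
    refine le_iInf fun t => ?_
    refine ge_of_tendsto' (HasOuterApproxClosed.tendsto_lintegral_apprSeq
      (isOpen_finiteBasisUnion t.1).isClosed_compl (μ : Measure X)) fun n => ?_
    have hlim : Tendsto (fun ρ => apprSeqIntegrals ρ (t.1, n))
        (comap apprSeqIntegrals (𝓝 (apprSeqIntegrals μ))) (𝓝 (apprSeqIntegrals μ (t.1, n))) :=
      tendsto_pi_nhds.1 tendsto_comap (t.1, n)
    rcases (comap apprSeqIntegrals (𝓝 (apprSeqIntegrals μ))).eq_or_neBot with h | h
    · simp [h]
    refine le_trans (limsup_le_limsup (.of_forall fun ρ => ?_)) hlim.limsup_eq.le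
    refine (measure_mono ?_).trans (HasOuterApproxClosed.measure_le_lintegral _ _ n)
    exact Set.subset_compl_comm.1 (Set.iUnion₂_subset t.2)

/-- Preimages of narrowly open sets under a (Giry) measurable map are measurable. -/
theorem IsOpen.measurableSet_preimage_probabilityMeasure {X Ω : Type*} [TopologicalSpace X]
    [SecondCountableTopology X] [HasOuterApproxClosed X] [MeasurableSpace X]
    [OpensMeasurableSpace X] [MeasurableSpace Ω] {F : Ω → ProbabilityMeasure X}
    (hF : Measurable F) {V : Set (ProbabilityMeasure X)} (hV : IsOpen V) :
    MeasurableSet (F ⁻¹' V) := by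
  have : Countable (TopologicalSpace.countableBasis X) :=
    (TopologicalSpace.countable_countableBasis X).to_subtype
  obtain ⟨O, hO, rfl⟩ := (isInducing_apprSeqIntegrals X).isOpen_iff.1 hV
  rw [← Set.preimage_comp]
  refine (measurable_pi_lambda _ fun p => ?_) hO.measurableSet
  exact (Measure.measurable_lintegral
    (BoundedContinuousFunction.continuous _).measurable.coe_nnreal_ennreal).comp
    (measurable_subtype_coe.comp hF)

/-- A lower semicontinuous function on a set of probability measures is measurable along measurable
maps. -/
theorem LowerSemicontinuous.measurable_comp_probabilityMeasure {X Ω : Type*} [TopologicalSpace X]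
    [SecondCountableTopology X] [HasOuterApproxClosed X] [MeasurableSpace X]
    [OpensMeasurableSpace X] [MeasurableSpace Ω] {S : Set (ProbabilityMeasure X)} {J : S → ℝ≥0∞}
    (hJ : LowerSemicontinuous J) {F : Ω → S}
    (hF : Measurable fun w => (F w : ProbabilityMeasure X)) : Measurable fun w => J (F w) := by
  refine measurable_of_Ioi fun c => ?_
  obtain ⟨V, hV, hVJ⟩ := isOpen_induced_iff.1 (hJ.isOpen_preimage c)
  have : (fun w => J (F w)) ⁻¹' Set.Ioi c = (fun w => (F w : ProbabilityMeasure X)) ⁻¹' V := by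
    change F ⁻¹' (J ⁻¹' Set.Ioi c) = _
    rw [← hVJ]
    rfl
  rw [this]
  exact hV.measurableSet_preimage_probabilityMeasure hF

/-! ### Continuity and measurability of the dynamics. -/

/-- The extended continuous mapping theorem: continuous maps that converge continuously preserve
narrow convergence. -/
theorem ProbabilityMeasure.tendsto_map_of_tendsto_prod {A C : Type*} [TopologicalSpace A]
    [HasOuterApproxClosed A] [MeasurableSpace A] [BorelSpace A] [TopologicalSpace C]
    [MeasurableSpace C] [BorelSpace C] {μs : ℕ → ProbabilityMeasure A} {μ : ProbabilityMeasure A}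
    (hμ : Tendsto μs atTop (𝓝 μ)) {Ts : ℕ → A → C} {T : A → C} (hTs : ∀ n, Measurable (Ts n))
    (hT : Measurable T)
    (hlim : ∀ x, Tendsto (fun p : ℕ × A => Ts p.1 p.2) (atTop ×ˢ 𝓝 x) (𝓝 (T x))) :
    Tendsto (fun n => (μs n).map (hTs n).aemeasurable) atTop (𝓝 (μ.map hT.aemeasurable)) := by
  refine tendsto_of_forall_isOpen_le_liminf' fun G hG => ?_
  simp only [ProbabilityMeasure.toMeasure_map]
  rw [Measure.map_apply hT hG.measurableSet]
  -- These open sets do not vary with `n`, so the portmanteau bound for `μs` applies to each; they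
  -- increase and, by continuous convergence, cover `T ⁻¹' G`.
  let D : ℕ → Set A := fun m => interior {y | ∀ n ≥ m, Ts n y ∈ G}
  have hD : Monotone D := fun m m' hmm => interior_mono fun y hy n hn => hy n (hmm.trans hn)
  have hcover : T ⁻¹' G ⊆ ⋃ m, D m := by
    intro x hx
    obtain ⟨s, hs, t, ht, hst⟩ := mem_prod_iff.1 (hlim x (hG.mem_nhds hx))
    obtain ⟨m, hm⟩ := mem_atTop_sets.1 hs
    refine Set.mem_iUnion.2 ⟨m, mem_interior_iff_mem_nhds.2 ?_⟩
    filter_upwards [ht] with y hy n hn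
    exact @hst (n, y) ⟨hm n hn, hy⟩
  refine (measure_mono hcover).trans ?_
  rw [hD.measure_iUnion]
  refine iSup_le fun m => ?_
  refine (ProbabilityMeasure.le_liminf_measure_open_of_tendsto hμ isOpen_interior).trans ?_
  refine liminf_le_liminf ?_
  filter_upwards [eventually_ge_atTop m] with n hn
  rw [Measure.map_apply (hTs n) hG.measurableSet]
  exact measure_mono fun y hy => interior_subset hy n hn

/-- On a first countable space, convergence in the compact-open topology implies continuous
convergence. -/
theorem ContinuousMap.tendsto_prod_nhds_of_tendsto {A B : Type*} [TopologicalSpace A]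
    [FirstCountableTopology A] [TopologicalSpace B] {us : ℕ → C(A, B)} {u : C(A, B)}
    (hu : Tendsto us atTop (𝓝 u)) (x : A) :
    Tendsto (fun p : ℕ × A => us p.1 p.2) (atTop ×ˢ 𝓝 x) (𝓝 (u x)) := by
  refine tendsto_of_seq_tendsto fun p hp => ?_
  have h1 : Tendsto (fun j => (p j).1) atTop atTop := tendsto_fst.comp hp
  have h2 : Tendsto (fun j => (p j).2) atTop (𝓝 x) := tendsto_snd.comp hp
  refine tendsto_nhds.2 fun V hV hxV => ?_
  obtain ⟨j₀, hj₀⟩ := eventually_atTop.1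
    (h2.eventually ((hV.preimage u.continuous).mem_nhds hxV))
  -- A convergent tail together with its limit is compact, so convergence in the compact-open
  -- topology can be tested on it.
  have hK : IsCompact (insert x (Set.range fun j => (p (j + j₀)).2)) :=
    (h2.comp (tendsto_add_atTop_nat j₀)).isCompact_insert_range
  have hmaps : Set.MapsTo u (insert x (Set.range fun j => (p (j + j₀)).2)) V := by
    rintro _ (rfl | ⟨j, rfl⟩)
    · exact hxV
    · exact hj₀ _ (Nat.le_add_left _ _)
  filter_upwards [h1.eventually (hu.eventually (ContinuousMap.eventually_mapsTo hK hV hmaps)),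
    eventually_ge_atTop j₀] with j hj hjj
  exact hj (Or.inr ⟨j - j₀, by simp [Nat.sub_add_cancel hjj]⟩)

theorem nextMeasure_eq_map {A B C : Type*} [TopologicalSpace A] [MeasurableSpace A]
    [BorelSpace A] [TopologicalSpace B] [TopologicalSpace C] [PolishSpace C] [MeasurableSpace C]
    [BorelSpace C] [AddMonoid C] [ContinuousAdd C] (f : C(A × B, C)) (u : C(A, B))
    (ν : ProbabilityMeasure C) (μ : ProbabilityMeasure A) :
    nextMeasure f u ν μ = ((μ.map (f.continuous.comp
      (continuous_id.prodMk u.continuous)).measurable.aemeasurable).prod ν).map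
        (continuous_add (M := C)).measurable.aemeasurable :=
  rfl

/-- The next state depends continuously on the state and the input map. -/
theorem tendsto_nextMeasure {A B C : Type*} [TopologicalSpace A] [FirstCountableTopology A]
    [HasOuterApproxClosed A] [MeasurableSpace A]
    [BorelSpace A] [TopologicalSpace B] [TopologicalSpace C] [PolishSpace C] [MeasurableSpace C]
    [BorelSpace C] [AddMonoid C] [ContinuousAdd C] (f : C(A × B, C)) {us : ℕ → C(A, B)}
    {u : C(A, B)} (hu : Tendsto us atTop (𝓝 u)) (ν : ProbabilityMeasure C)
    {μs : ℕ → ProbabilityMeasure A} {μ : ProbabilityMeasure A} (hμ : Tendsto μs atTop (𝓝 μ)) :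
    Tendsto (fun n => nextMeasure f (us n) ν (μs n)) atTop (𝓝 (nextMeasure f u ν μ)) := by
  simp only [nextMeasure_eq_map]
  refine ((ProbabilityMeasure.continuous_map continuous_add).tendsto _).comp ?_
  refine (ProbabilityMeasure.continuous_prod.tendsto (_, ν)).comp
    (Tendsto.prodMk_nhds ?_ tendsto_const_nhds)
  refine ProbabilityMeasure.tendsto_map_of_tendsto_prod hμ
    (fun n => (f.continuous.comp (continuous_id.prodMk (us n).continuous)).measurable)
    (f.continuous.comp (continuous_id.prodMk u.continuous)).measurable fun x => ?_
  exact (f.continuous.tendsto (x, u x)).comp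
    (tendsto_snd.prodMk_nhds (ContinuousMap.tendsto_prod_nhds_of_tendsto hu x))

theorem measurable_nextMeasure {A B C Ω : Type*} [TopologicalSpace A]
    [TopologicalSpace.MetrizableSpace A] [SecondCountableTopology A] [MeasurableSpace A]
    [BorelSpace A] [TopologicalSpace B] [TopologicalSpace C] [PolishSpace C] [MeasurableSpace C]
    [BorelSpace C] [AddMonoid C] [ContinuousAdd C] [MeasurableSpace Ω] {f : Ω → C(A × B, C)}
    (hf : ∀ x u, Measurable fun w => f w (x, u)) (u : C(A, B)) (ν : ProbabilityMeasure C)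
    (μ : ProbabilityMeasure A) : Measurable fun w => nextMeasure (f w) u ν μ := by
  have hT : ∀ w, Measurable fun x => f w (x, u x) := fun w =>
    ((f w).continuous.comp (continuous_id.prodMk u.continuous)).measurable
  have hjoint : Measurable fun p : Ω × A => f p.1 (p.2, u p.2) :=
    (measurable_uncurry_of_continuous_of_measurable (u := fun x w => f w (x, u x))
      (fun w => (f w).continuous.comp (continuous_id.prodMk u.continuous))
      fun x => hf x (u x)).comp measurable_swap
  have hsum : Measurable fun p : Ω × A × C => f p.1 (p.2.1, u p.2.1) + p.2.2 :=
    (hjoint.comp (measurable_fst.prodMk measurable_snd.fst)).add measurable_snd.snd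
  refine Measurable.subtype_mk (Measure.measurable_of_measurable_coe _ fun s hs => ?_)
  -- The mass of `s` is the `μ ⊗ ν` measure of the slice at `w` of a jointly measurable set.
  convert measurable_measure_prodMk_left (ν := (μ : Measure A).prod (ν : Measure C))
    (hsum hs) using 2 with w
  have hprod := Measure.map_prod_map (μ : Measure A) (ν : Measure C) (hT w) measurable_id
  rw [Measure.map_id] at hprod
  rw [Measure.conv, hprod, Measure.map_map measurable_add ((hT w).prodMap measurable_id),
    Measure.map_apply (measurable_add.comp ((hT w).prodMap measurable_id)) hs]
  rfl

/-! ### Sequential compactness of inputs and the Fatou argument. -/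

/-- Compact sets of a space that injects continuously into a first countable Hausdorff space are
sequentially compact. -/
theorem IsCompact.isSeqCompact_of_continuous_injective {V M : Type*} [TopologicalSpace V]
    [TopologicalSpace M] [T2Space M] [FirstCountableTopology M] {ψ : V → M} (hψ : Continuous ψ)
    (hinj : Function.Injective ψ) {K : Set V} (hK : IsCompact K) : IsSeqCompact K := by
  have : CompactSpace K := isCompact_iff_compactSpace.1 hK
  -- A continuous injection of a compact space into a Hausdorff space is an embedding, so `K`
  -- inherits first countability.
  have : FirstCountableTopology K :=
    ((hψ.comp continuous_subtype_val).isClosedEmbedding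
      (hinj.comp Subtype.val_injective)).isInducing.firstCountableTopology
  intro x hx
  obtain ⟨a, φ, hφ, ha⟩ := SeqCompactSpace.tendsto_subseq fun n => (⟨x n, hx n⟩ : K)
  exact ⟨a, a.2, φ, hφ, (continuous_subtype_val.tendsto a).comp ha⟩

/-- Compact sets of continuous maps from a separable space to a metrizable space are sequentially
compact for the compact-open topology. -/
theorem ContinuousMap.isSeqCompact_of_isCompact {A B : Type*} [TopologicalSpace A]
    [TopologicalSpace.SeparableSpace A] [TopologicalSpace B] [T2Space B]
    [FirstCountableTopology B] {I : Set C(A, B)} {K : Set I} (hK : IsCompact K) :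
    IsSeqCompact K := by
  obtain ⟨D, hDc, hD⟩ := TopologicalSpace.exists_countable_dense A
  have : Countable D := hDc.to_subtype
  -- Evaluation on a countable dense set is injective on continuous maps, and a countable power of a
  -- first countable space is first countable.
  refine hK.isSeqCompact_of_continuous_injective (ψ := fun (u : I) (x : D) => u.1 x)
    (continuous_pi fun x => (continuous_eval_const _).comp continuous_subtype_val)
    fun u v huv => Subtype.ext (DFunLike.coe_injective ?_)
  exact Continuous.ext_on hD u.1.continuous v.1.continuous fun x hx => congrFun huv ⟨x, hx⟩

theorem SeqLowerSemicontinuous.lowerSemicontinuous {α : Type*} [TopologicalSpace α]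
    [FirstCountableTopology α] {f : α → ℝ≥0∞} (hf : SeqLowerSemicontinuous f) :
    LowerSemicontinuous f := by
  refine lowerSemicontinuous_iff_le_liminf.2 fun x => ?_
  obtain ⟨a, ha, hax⟩ := exists_seq_tendsto_liminf (u := f) (f := 𝓝 x)
  exact (hf a x hax).trans ha.liminf_eq.le

/-- Expectations of coercive, lower semicontinuous functions: along a convergent sequence of states
and any inputs, some input does at least as well in the limit. -/
theorem exists_lintegral_le_liminf {S V Ω : Type*} [TopologicalSpace S] [TopologicalSpace V]
    [Nonempty V] (hV : ∀ K : Set V, IsCompact K → IsSeqCompact K) [MeasurableSpace Ω]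
    (ξ : Measure Ω) [NeZero ξ] {q : S → V → Ω → ℝ≥0∞} (hmeas : ∀ μ u, Measurable (q μ u))
    (hlsc : ∀ w, SeqLowerSemicontinuous fun p : S × V => q p.1 p.2 w)
    (hcoer : ∀ w, MeasureControlProblem.CoerciveInInput fun μ u => q μ u w)
    {μs : ℕ → S} {μ : S} (hμ : Tendsto μs atTop (𝓝 μ)) (us : ℕ → V) :
    ∃ u, ∫⁻ w, q μ u w ∂ξ ≤ liminf (fun n => ∫⁻ w, q (μs n) (us n) w ∂ξ) atTop := by
  obtain ⟨φ, hφL, hφ⟩ := exists_seq_tendsto_liminf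
    (u := fun n => ∫⁻ w, q (μs n) (us n) w ∂ξ) (f := atTop)
  set L := liminf (fun n => ∫⁻ w, q (μs n) (us n) w ∂ξ) atTop
  rcases eq_or_ne L ∞ with hL | hL
  · exact ⟨Classical.arbitrary V, hL ▸ le_top⟩
  have hfatou : ∫⁻ w, liminf (fun n => q (μs (φ n)) (us (φ n)) w) atTop ∂ξ ≤ L :=
    (lintegral_liminf_le fun n => hmeas _ _).trans hφL.liminf_eq.le
  -- One noise value is enough, since the inputs do not depend on it.
  obtain ⟨w, hw⟩ : ∃ w, liminf (fun n => q (μs (φ n)) (us (φ n)) w) atTop < ∞ := by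
    by_contra! h
    refine hL (top_le_iff.1 (le_trans ?_ hfatou))
    simp [top_le_iff.1 (h _), ENNReal.top_mul (NeZero.ne (ξ Set.univ))]
  obtain ⟨c, hwc, hc⟩ := ENNReal.lt_iff_exists_nnreal_btwn.1 hw
  obtain ⟨θ, hθ, hθc⟩ := extraction_of_frequently_atTop
    (frequently_lt_of_liminf_lt (by isBoundedDefault) hwc)
  obtain ⟨K, hK, hKu⟩ := hcoer w _ hμ.isCompact_insert_range c
  obtain ⟨u, -, χ, hχ, hu⟩ := hV K hK fun n =>
    hKu (μs (φ (θ n))) (Or.inr ⟨_, rfl⟩) (us (φ (θ n))) (hθc n).le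
  have hsub : Tendsto (fun n => φ (θ (χ n))) atTop atTop :=
    hφ.comp (hθ.tendsto_atTop.comp hχ.tendsto_atTop)
  refine ⟨u, ?_⟩
  calc ∫⁻ w, q μ u w ∂ξ
      ≤ ∫⁻ w, liminf (fun n => q (μs (φ (θ (χ n)))) (us (φ (θ (χ n)))) w) atTop ∂ξ :=
        lintegral_mono fun w => hlsc w _ (μ, u) ((hμ.comp hsub).prodMk_nhds hu)
    _ ≤ liminf (fun n => ∫⁻ w, q (μs (φ (θ (χ n)))) (us (φ (θ (χ n)))) w ∂ξ) atTop :=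
        lintegral_liminf_le fun n => hmeas _ _
    _ = L := (hφL.comp (hθ.tendsto_atTop.comp hχ.tendsto_atTop)).liminf_eq

/-- Superadditivity of the liminf: tail infima increase, so the sum of their suprema is the supremum
of their sums. -/
theorem SeqLowerSemicontinuous.add {α : Type*} [TopologicalSpace α] {f g : α → ℝ≥0∞}
    (hf : SeqLowerSemicontinuous f) (hg : SeqLowerSemicontinuous g) :
    SeqLowerSemicontinuous fun x => f x + g x := fun a b hab => by
  refine (add_le_add (hf a b hab) (hg a b hab)).trans ?_
  simp only [liminf_eq_iSup_iInf_of_nat]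
  rw [ENNReal.iSup_add_iSup_of_monotone
    (fun m n hmn => biInf_mono fun i hi => hmn.trans hi)
    (fun m n hmn => biInf_mono fun i hi => hmn.trans hi)]
  exact iSup_mono fun n => le_iInf₂ fun i hi => add_le_add (iInf₂_le i hi) (iInf₂_le i hi)

/-! ### Backward induction for the cost-to-go. -/

namespace MeasureControlProblem

theorem CoerciveInInput.mono {S V : Type*} [TopologicalSpace S] [TopologicalSpace V]
    {g h : S → V → ℝ≥0∞} (hg : CoerciveInInput g) (hgh : ∀ μ u, g μ u ≤ h μ u) :
    CoerciveInInput h := fun C hC c => by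
  obtain ⟨K, hK, hKu⟩ := hg C hC c
  exact ⟨K, hK, fun μ hμ u hu => hKu μ hμ u ((hgh μ u).trans hu)⟩

variable {N : ℕ} {X : ℕ → Type*} {U : ℕ → Type*} {W : ℕ → Type*}
  [∀ k, TopologicalSpace (X k)] [∀ k, PolishSpace (X k)] [∀ k, MeasurableSpace (X k)]
  [∀ k, BorelSpace (X k)] [∀ k, AddMonoid (X k)] [∀ k, ContinuousAdd (X k)]
  [∀ k, TopologicalSpace (U k)] [∀ k, MeasurableSpace (W k)]
  {P : MeasureControlProblem N X U W}

/-- Merges the two alternatives: with compact inputs, the whole input set serves as `K`. -/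
theorem StandingHypotheses.coerciveInInput (hP : P.StandingHypotheses) {k : ℕ} (hk : k < N)
    (w : W k) : CoerciveInInput fun μ u => P.stageCost k μ u w := by
  rcases hP.compact_or_coercive k hk with h | h
  · have : CompactSpace (P.inputs k) := isCompact_iff_compactSpace.1 h
    exact fun _ _ _ => ⟨Set.univ, isCompact_univ, fun _ _ _ _ => Set.mem_univ _⟩
  · exact h w

theorem tendsto_dynamics (P : MeasureControlProblem N X U W) {k : ℕ} (w : W k)
    {a : ℕ → P.states k × P.inputs k} {b : P.states k × P.inputs k}
    (hab : Tendsto a atTop (𝓝 b)) :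
    Tendsto (fun n => P.dynamics k (a n).1 (a n).2 w) atTop (𝓝 (P.dynamics k b.1 b.2 w)) := by
  refine tendsto_subtype_rng.2 (tendsto_nextMeasure _ ?_ _ ?_)
  · exact (continuous_subtype_val.tendsto _).comp ((continuous_snd.tendsto b).comp hab)
  · exact (continuous_subtype_val.tendsto _).comp ((continuous_fst.tendsto b).comp hab)

/-- The measurability of the integrand in the recursion. -/
theorem StandingHypotheses.measurable_integrand (hP : P.StandingHypotheses) {k : ℕ} (hk : k < N)
    (hJ : LowerSemicontinuous (P.costToGo (k + 1))) (μ : P.states k) (u : P.inputs k) :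
    Measurable fun w => P.stageCost k μ u w + P.costToGo (k + 1) (P.dynamics k μ u w) :=
  (hP.measurable_stageCost k hk μ u).add (hJ.measurable_comp_probabilityMeasure
    (measurable_nextMeasure (hP.measurable_f k hk) u.1 (P.ν k) μ.1))

theorem StandingHypotheses.exists_inputValue_le_liminf [∀ k, T2Space (U k)]
    [∀ k, FirstCountableTopology (U k)] (hP : P.StandingHypotheses) {k : ℕ} (hk : k < N)
    (hJ : LowerSemicontinuous (P.costToGo (k + 1))) {μs : ℕ → P.states k} {μ : P.states k}
    (hμ : Tendsto μs atTop (𝓝 μ)) (us : ℕ → P.inputs k) :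
    ∃ u, P.inputValue k μ u ≤ liminf (fun n => P.inputValue k (μs n) (us n)) atTop := by
  have : Nonempty (P.inputs k) := (P.inputs_nonempty k).to_subtype
  refine exists_lintegral_le_liminf
    (q := fun μ u w => P.stageCost k μ u w + P.costToGo (k + 1) (P.dynamics k μ u w))
    (fun K hK => ContinuousMap.isSeqCompact_of_isCompact hK) (P.ξ k : Measure (W k))
    (hP.measurable_integrand hk hJ) (fun w => (hP.stageCost_lsc k hk w).add ?_)
    -- Adding the nonnegative cost-to-go only shrinks sublevel sets.
    (fun w => (hP.coerciveInInput hk w).mono fun μ u => le_self_add) hμ us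
  exact fun a b hab => hJ.seqLowerSemicontinuous _ _ (P.tendsto_dynamics w hab)

theorem StandingHypotheses.exists_costToGo_eq [∀ k, T2Space (U k)]
    [∀ k, FirstCountableTopology (U k)] (hP : P.StandingHypotheses) {k : ℕ} (hk : k < N)
    (hJ : LowerSemicontinuous (P.costToGo (k + 1))) (μ : P.states k) :
    ∃ u, P.costToGo k μ = P.inputValue k μ u := by
  have : Nonempty (P.inputs k) := (P.inputs_nonempty k).to_subtype
  obtain ⟨v, -, hv, hvmem⟩ := exists_seq_tendsto_sInf
    (Set.range_nonempty (P.inputValue k μ)) (OrderBot.bddBelow _)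
  choose us hus using hvmem
  obtain ⟨u, hu⟩ := hP.exists_inputValue_le_liminf hk hJ (tendsto_const_nhds (x := μ)) us
  refine ⟨u, le_antisymm (P.costToGo_of_lt hk μ ▸ iInf_le _ u) ?_⟩
  rw [P.costToGo_of_lt hk]
  refine hu.trans ?_
  simp only [hus]
  exact hv.liminf_eq.le

theorem StandingHypotheses.lowerSemicontinuous_costToGo [∀ k, T2Space (U k)]
    [∀ k, FirstCountableTopology (U k)] (hP : P.StandingHypotheses) {k : ℕ} (hk : k ≤ N) :
    LowerSemicontinuous (P.costToGo k) := by
  induction hk using Nat.decreasingInduction with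
  | self => exact P.costToGo_terminal ▸ hP.terminalCost_lsc
  | of_succ k hk hJ =>
    -- Sequences suffice because the narrow topology is first countable here.
    refine SeqLowerSemicontinuous.lowerSemicontinuous fun μs μ hμ => ?_
    choose us hus using fun n => hP.exists_costToGo_eq hk hJ (μs n)
    obtain ⟨u, hu⟩ := hP.exists_inputValue_le_liminf hk hJ hμ us
    simp only [hus]
    exact (P.costToGo_of_lt hk μ ▸ iInf_le _ u).trans hu

/-! ### Verification: policies versus the recursion. -/

/-- Constants leave even a lower integral against a probability measure, so arbitrary policies are
covered. This turns the accumulated form into a Bellman equation for the expected cost. -/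
theorem accumulatedCost_eq_add (P : MeasureControlProblem N X U W) (π : P.Policy) {k : ℕ}
    (hk : k ≤ N) (c : ℝ≥0∞) (μ : P.states k) :
    P.accumulatedCost π k c μ = c + P.expectedCost π k μ := by
  induction hk using Nat.decreasingInduction generalizing c with
  | self => simp [expectedCost, accumulatedCost_terminal]
  | of_succ k hk ih =>
    rw [expectedCost, accumulatedCost_of_lt _ _ hk, accumulatedCost_of_lt _ _ hk]
    simp only [ih, zero_add, add_assoc]
    rw [lintegral_add_left measurable_const]
    simp

theorem expectedCost_of_lt (P : MeasureControlProblem N X U W) (π : P.Policy) {k : ℕ}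
    (hk : k < N) (μ : P.states k) :
    P.expectedCost π k μ = ∫⁻ w, (P.stageCost k μ (π k μ) w +
      P.expectedCost π (k + 1) (P.dynamics k μ (π k μ) w)) ∂(P.ξ k : Measure (W k)) := by
  rw [expectedCost, accumulatedCost_of_lt _ _ hk]
  simp only [accumulatedCost_eq_add P π hk, zero_add]

theorem expectedCost_terminal (P : MeasureControlProblem N X U W) (π : P.Policy) :
    P.expectedCost π N = P.costToGo N := by
  funext μ
  simp [expectedCost, accumulatedCost_terminal, costToGo_terminal]

theorem costToGo_le_expectedCost (P : MeasureControlProblem N X U W) (π : P.Policy) {k : ℕ}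
    (hk : k ≤ N) (μ : P.states k) : P.costToGo k μ ≤ P.expectedCost π k μ := by
  induction hk using Nat.decreasingInduction with
  | self => rw [expectedCost_terminal]
  | of_succ k hk ih =>
    rw [costToGo_of_lt _ hk, expectedCost_of_lt _ _ hk]
    exact (iInf_le _ (π k μ)).trans (lintegral_mono fun w => add_le_add le_rfl (ih _))

theorem isMinOn_inputValue_iff (P : MeasureControlProblem N X U W) {k : ℕ} (hk : k < N)
    (μ : P.states k) (u : P.inputs k) :
    IsMinOn (P.inputValue k μ) Set.univ u ↔ P.costToGo k μ = P.inputValue k μ u := by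
  rw [costToGo_of_lt _ hk, isMinOn_univ_iff]
  exact ⟨fun h => le_antisymm (iInf_le _ u) (le_iInf h), fun h v => h ▸ iInf_le _ v⟩

theorem SolvesRecursion.expectedCost_eq {π : P.Policy} (hπ : P.SolvesRecursion π) {k : ℕ}
    (hk : k ≤ N) (μ : P.states k) : P.expectedCost π k μ = P.costToGo k μ := by
  induction hk using Nat.decreasingInduction with
  | self => rw [expectedCost_terminal]
  | of_succ k hk ih =>
    rw [expectedCost_of_lt _ _ hk, (P.isMinOn_inputValue_iff hk μ _).1 (hπ k hk μ), inputValue]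
    simp only [ih]

/-- No measurable selection is needed: whichever minimizers are picked, the cost of the remaining
stages is the cost-to-go, so each integrand is a constant plus that of the recursion. -/
theorem SolvesRecursion.admissible [∀ k, T2Space (U k)] [∀ k, FirstCountableTopology (U k)]
    (hP : P.StandingHypotheses) {π : P.Policy} (hπ : P.SolvesRecursion π) : P.Admissible π := by
  intro k hk c μ
  simp only [accumulatedCost_eq_add P π (Nat.succ_le_of_lt hk), hπ.expectedCost_eq hk, add_assoc]
  exact (hP.measurable_integrand hk (hP.lowerSemicontinuous_costToGo hk) μ _).const_add c

theorem StandingHypotheses.exists_solvesRecursion [∀ k, T2Space (U k)]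
    [∀ k, FirstCountableTopology (U k)] (hP : P.StandingHypotheses) :
    ∃ π : P.Policy, P.SolvesRecursion π := by
  have h : ∀ k (μ : P.states k), ∃ u, k < N → IsMinOn (P.inputValue k μ) Set.univ u := by
    intro k μ
    by_cases hk : k < N
    · obtain ⟨u, hu⟩ := hP.exists_costToGo_eq hk (hP.lowerSemicontinuous_costToGo hk) μ
      exact ⟨u, fun _ => (P.isMinOn_inputValue_iff hk μ u).2 hu⟩
    · exact ⟨⟨_, (P.inputs_nonempty k).some_mem⟩, fun h => absurd h hk⟩
  choose π hπ using h
  exact ⟨π, fun k hk μ => hπ k μ hk⟩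

theorem StandingHypotheses.costToGo_eq_optimalCost [∀ k, T2Space (U k)]
    [∀ k, FirstCountableTopology (U k)] (hP : P.StandingHypotheses) {k : ℕ} (hk : k ≤ N)
    (μ : P.states k) : P.costToGo k μ = P.optimalCost k μ := by
  obtain ⟨π, hπ⟩ := hP.exists_solvesRecursion
  refine le_antisymm (le_iInf₂ fun ρ _ => P.costToGo_le_expectedCost ρ hk μ) ?_
  exact (iInf₂_le π (hπ.admissible hP)).trans (hπ.expectedCost_eq hk μ).le

/-- Optimality at stage `k + 1` turns the Bellman equation of the policy into its input value at
stage `k`; optimality at `k` makes that value minimal. -/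
theorem solvesRecursion_of_expectedCost_eq {π : P.Policy}
    (hπ : ∀ k ≤ N, ∀ μ : P.states k, P.expectedCost π k μ = P.costToGo k μ) :
    P.SolvesRecursion π := by
  intro k hk μ
  rw [isMinOn_inputValue_iff P hk, ← hπ k hk.le, expectedCost_of_lt _ _ hk, inputValue]
  simp only [hπ (k + 1) hk]

end MeasureControlProblem

theorem mainTheorem1 {N : ℕ} {X : ℕ → Type*} {U : ℕ → Type*} {W : ℕ → Type*}
    [∀ k, TopologicalSpace (X k)] [∀ k, PolishSpace (X k)] [∀ k, MeasurableSpace (X k)]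
    [∀ k, BorelSpace (X k)] [∀ k, AddMonoid (X k)] [∀ k, ContinuousAdd (X k)]
    [∀ k, TopologicalSpace (U k)] [∀ k, TopologicalSpace.MetrizableSpace (U k)]
    [∀ k, MeasurableSpace (W k)]
    (P : MeasureControlProblem N X U W) (hP : P.StandingHypotheses) :
    -- every cost-to-go is lower semicontinuous for narrow convergence
    (∀ k ≤ N, LowerSemicontinuous (P.costToGo k)) ∧
    -- the integrands of the recursion are measurable
    (∀ k < N, ∀ (μ : P.states k) (u : P.inputs k), Measurable fun w =>
      P.stageCost k μ u w + P.costToGo (k + 1) (P.dynamics k μ u w)) ∧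
    -- the minimum in the recursion is attained
    (∀ k < N, ∀ μ : P.states k, ∃ u : P.inputs k,
      IsMinOn (P.inputValue k μ) Set.univ u ∧ P.costToGo k μ = P.inputValue k μ u) ∧
    -- the cost-to-go is the optimal cost; `k = 0` is the control problem itself
    (∀ k ≤ N, ∀ μ : P.states k, P.costToGo k μ = P.optimalCost k μ) ∧
    -- there are policies that solve the recursion, and they are exactly the optimal policies
    (∃ π : P.Policy, P.SolvesRecursion π) ∧
    (∀ π : P.Policy, P.SolvesRecursion π ↔
      P.Admissible π ∧ ∀ k ≤ N, ∀ μ : P.states k, P.expectedCost π k μ = P.optimalCost k μ) := by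
  refine ⟨fun k hk => hP.lowerSemicontinuous_costToGo hk,
    fun k hk => hP.measurable_integrand hk (hP.lowerSemicontinuous_costToGo hk),
    fun k hk μ => ?_, fun k hk => hP.costToGo_eq_optimalCost hk, hP.exists_solvesRecursion,
    fun π => ⟨fun hπ => ⟨hπ.admissible hP, fun k hk μ => ?_⟩, fun hπ => ?_⟩⟩
  · obtain ⟨u, hu⟩ := hP.exists_costToGo_eq hk (hP.lowerSemicontinuous_costToGo hk) μ
    exact ⟨u, (P.isMinOn_inputValue_iff hk μ u).2 hu, hu⟩
  · rw [hπ.expectedCost_eq hk, hP.costToGo_eq_optimalCost hk]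
  · exact MeasureControlProblem.solvesRecursion_of_expectedCost_eq fun k hk μ =>
      (hπ.2 k hk μ).trans (hP.costToGo_eq_optimalCost hk μ).symm
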